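/- Let $J\ge 1$ and consider a tandem line of $J$ stations with finite buffers $B_1,\dots,B_J\in\mathbb Z_+$ and exponential service rates $\mu_1,\dots,\mu_J>0$. Customers arrive at station $1$ in a Poisson stream of rate $\lambda\in(0,\infty)$ with i.i.d. reservation prices with distribution function $F$; write $F(a-)$ for its left limit at $a$. Prices are quoted from a set $\mathcal A\subset[0,\infty)$ such that $1-F(a-)>0$ for all $a\in\mathcal A$ and such that $\max\{a\lambda(1-F(a-)):a\in\mathcal A\}$ exists (for instance, $\mathcal A$ finite and non-empty). The state space is $\mathcal S=\prod_{j=1}^J\{0,1,\dots,B_j+1\}$, where $s_j$ is the number of jobs at station $j$, and a pricing policy is a function $\pi:\mathcal S\to\mathcal A$. Under $\pi$ the state is a continuous-time Markov chain $(\mathbf X^\pi(t))_{t\ge0}$ on $\mathcal S$ with right-continuous paths, whose transition rates between states of $\mathcal S$ are $\lambda(1-F(\pi(\mathbf s)-))$ from $\mathbf s$ to $\mathbf s+\mathbf e_1$, $\mu_j$ from $\mathbf s$ to $\mathbf s-\mathbf e_j+\mathbf e_{j+1}$ ($1\le j<J$), $\mu_J$ from $\mathbf s$ to $\mathbf s-\mathbf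 e_J$, and $0$ otherwise. Let $T_0^\pi=0$, $T_{n+1}^\pi=\inf\{t>T_n^\pi:\mathbf X^\pi(t)\ne\mathbf X^\pi(t-)\}$, and let $R^\pi(\mathbf s,\mathbf s')=\pi(\mathbf s)$ if $\mathbf s'=\mathbf s+\mathbf e_1$ and $R^\pi(\mathbf s,\mathbf s')=0$ otherwise. Then for every pricing policy $\pi$ the gain (long-run expected time-average revenue) $$g^\pi=\lim_{T\to\infty}\frac1T\,\mathbb E\Big[\sum_{n\ge1:\,T^\pi_n\le T}R^\pi\big(\mathbf X^\pi(T^\pi_{n-1}),\mathbf X^\pi(T^\pi_n)\big)\Big]$$ is well defined (the expectations are finite, and the limit exists, is finite and is the same for every initial state), and $$g^\pi\ \le\ \max\{a\lambda(1-F(a-)):a\in\mathcal A\}.$$ Consequently the optimal gain $\sup_\pi g^\pi$ (a maximum if $\mathcal A$ is finite) is also at most $\max\{a\lambda(1-F(a-)):a\in\mathcal A\}$. -/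

import Mathlib

open MeasureTheory ProbabilityTheory Filter Topology
open scoped NNReal ENNReal

noncomputable section

/-! ### Continuous-time Markov chains on a finite state space -/

/-- A conservative generator (Q-matrix) on a finite set `S`. -/
structure Generator (S : Type) [Fintype S] where
  Q : S → S → ℝ
  nonneg : ∀ s s', s ≠ s' → 0 ≤ Q s s'
  sum_zero : ∀ s, ∑ s', Q s s' = 0

namespace Generator

variable {S : Type} [Fintype S]

/-- The total rate at which the chain leaves the state `s`. -/
def exitRate (G : Generator S) (s : S) : ℝ := -G.Q s s

variable [DecidableEq S]

theorem sum_erase (G : Generator S) (s : S) :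
    ∑ s' ∈ Finset.univ.erase s, G.Q s s' = G.exitRate s := by
  have h := Finset.add_sum_erase Finset.univ (G.Q s) (Finset.mem_univ s)
  rw [G.sum_zero s] at h
  unfold exitRate
  linarith

variable [MeasurableSpace S]

/-- The law of the state after the next jump out of `s`: it is `s'` with probability
`Q s s' / exitRate s`. An absorbing state is never left. -/
def jumpLaw (G : Generator S) (s : S) : Measure S :=
  if 0 < G.exitRate s then
    ∑ s' ∈ Finset.univ.erase s, ENNReal.ofReal (G.Q s s' / G.exitRate s) • Measure.dirac s'
  else Measure.dirac s

/-- The law of the time spent in `s`: exponential with rate `exitRate s`. In an absorbing state,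
where the jump law leads back to `s`, the duration of a stage is irrelevant and set to `1`. -/
def holdLaw (G : Generator S) (s : S) : Measure ℝ :=
  if 0 < G.exitRate s then expMeasure (G.exitRate s) else Measure.dirac 1

instance isProbabilityMeasure_jumpLaw (G : Generator S) (s : S) :
    IsProbabilityMeasure (G.jumpLaw s) := by
  unfold jumpLaw
  split_ifs with h
  · constructor
    have h1 : ∀ s' ∈ Finset.univ.erase s, 0 ≤ G.Q s s' / G.exitRate s := fun s' hs' =>
      div_nonneg (G.nonneg s s' (Finset.ne_of_mem_erase hs').symm) h.le
    simp only [Measure.coe_finsetSum, Finset.sum_apply, Measure.smul_apply, measure_univ,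
      smul_eq_mul, mul_one]
    rw [← ENNReal.ofReal_sum_of_nonneg h1, ← Finset.sum_div, G.sum_erase, div_self h.ne',
      ENNReal.ofReal_one]
  · infer_instance

instance isProbabilityMeasure_holdLaw (G : Generator S) (s : S) :
    IsProbabilityMeasure (G.holdLaw s) := by
  unfold holdLaw
  split_ifs with h
  · exact isProbabilityMeasure_expMeasure h
  · infer_instance

variable [DiscreteMeasurableSpace S]

/-- The law of a stage of the chain in state `s`: the state together with its holding time. -/
def stageKernel (G : Generator S) : Kernel S (S × ℝ) where
  toFun s := (Measure.dirac s).prod (G.holdLaw s)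
  measurable' := Measurable.of_discrete

instance (G : Generator S) : IsMarkovKernel G.stageKernel :=
  ⟨fun s => inferInstanceAs (IsProbabilityMeasure ((Measure.dirac s).prod (G.holdLaw s)))⟩

def jumpKernel (G : Generator S) : Kernel S S where
  toFun := G.jumpLaw
  measurable' := Measurable.of_discrete

instance (G : Generator S) : IsMarkovKernel G.jumpKernel :=
  ⟨fun s => G.isProbabilityMeasure_jumpLaw s⟩

/-- The law of stage `n + 1` given the stages `0, …, n`; it depends on the state of
stage `n` only. -/
def step (G : Generator S) (n : ℕ) : Kernel ((_ : Finset.Iic n) → S × ℝ) (S × ℝ) :=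
  (G.stageKernel ∘ₖ G.jumpKernel).comap
    (fun h => (h ⟨n, Finset.mem_Iic.2 le_rfl⟩).1)
    (measurable_fst.comp (measurable_pi_apply _))

instance (G : Generator S) (n : ℕ) : IsMarkovKernel (G.step n) := by
  unfold step
  infer_instance

/-- The law, on sequences of stages (state, holding time), of the continuous-time Markov chain
with generator `G` started in `s₀`. -/
def law (G : Generator S) (s₀ : S) : Measure (ℕ → S × ℝ) :=
  Kernel.trajMeasure (X := fun _ => S × ℝ) (G.stageKernel s₀) G.step

end Generator

/-- The state at time `t` of the right-continuous path that visits the states `(ω n).1` in turn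
and stays for the time `(ω n).2` in the `n`-th of them. -/
def chainAt {S : Type} (ω : ℕ → S × ℝ) (t : ℝ≥0) : S :=
  (ω (sInf {n : ℕ | (t : ℝ) < ∑ k ∈ Finset.range (n + 1), (ω k).2})).1

/-- `x (t-) ≠ x t`, for a path in a discrete space. -/
def ChangesAt {S : Type} (x : ℝ≥0 → S) (t : ℝ≥0) : Prop :=
  ¬ ∀ᶠ u in 𝓝[<] t, x u = x t

/-- The successive times at which a path changes, `T₀ = 0` and
`Tₙ₊₁ = inf {t > Tₙ : x (t-) ≠ x t}`, with value `∞` if there is no further change. -/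
def changeTime {S : Type} (x : ℝ≥0 → S) : ℕ → ℝ≥0∞
  | 0 => 0
  | n + 1 => sInf ((fun t : ℝ≥0 => (t : ℝ≥0∞)) '' {t | changeTime x n < t ∧ ChangesAt x t})

/-- The total reward `∑ R (x (Tₙ₋₁)) (x (Tₙ))` over all `n ≥ 1` with `Tₙ ≤ T`, for a non-negative
reward function `R` on transitions. -/
def totalReward {S : Type} (R : S → S → ℝ) (x : ℝ≥0 → S) (T : ℝ≥0) : ℝ≥0∞ :=
  open Classical in
  ∑' n : ℕ, if changeTime x (n + 1) ≤ T then
    ENNReal.ofReal (R (x (changeTime x n).toNNReal) (x (changeTime x (n + 1)).toNNReal)) else 0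

/-! ### The tandem queueing system -/

/-- A tandem line of `J` stations; stations are numbered `0, …, J - 1`. -/
structure TandemSystem (J : ℕ) where
  /-- buffer sizes, not counting the job in service -/
  B : Fin J → ℕ
  /-- service rates -/
  μ : Fin J → ℝ
  μ_pos : ∀ j, 0 < μ j
  /-- rate of the Poisson stream of incoming customers -/
  lam : ℝ
  lam_pos : 0 < lam
  /-- distribution of the reservation prices -/
  reservation : Measure ℝ
  prob : IsProbabilityMeasure reservation

namespace TandemSystem

variable {J : ℕ} (Θ : TandemSystem J)

/-- States: the number of jobs at station `j` ranges over `0, …, B j + 1`. -/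
abbrev State : Type := (j : Fin J) → Fin (Θ.B j + 2)

/-- `1 - F(a-)`, with `F` the distribution function of the reservation prices. -/
def entryProb (a : ℝ) : ℝ := 1 - Function.leftLim (cdf Θ.reservation) a

/-- The unit vector of station `k`; it is zero for `k = J`. -/
def unitVec (J k : ℕ) : Fin J → ℤ := fun i => if (i : ℕ) = k then 1 else 0

/-- `s' = s + e₀`: a customer enters station `0`. -/
def IsEntry (s s' : Θ.State) : Prop :=
  ∀ i, ((s' i : ℕ) : ℤ) = ((s i : ℕ) : ℤ) + unitVec J 0 i

/-- `s' = s - e_j + e_{j+1}`, which reads `s' = s - e_j` for the last station `j`: a job is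
completed at station `j`. As `s'` is a state, this needs a free place at station `j + 1`. -/
def IsService (j : Fin J) (s s' : Θ.State) : Prop :=
  ∀ i, ((s' i : ℕ) : ℤ) = ((s i : ℕ) : ℤ) - unitVec J j i + unitVec J (j + 1) i

instance (s s' : Θ.State) : Decidable (Θ.IsEntry s s') := by
  unfold IsEntry
  infer_instance

instance (j : Fin J) (s s' : Θ.State) : Decidable (Θ.IsService j s s') := by
  unfold IsService
  infer_instance

variable {A : Set ℝ} (π : Θ.State → A)

/-- The transition rates between different states under the pricing policy `π`. -/
def rate (s s' : Θ.State) : ℝ :=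
  if Θ.IsEntry s s' then Θ.lam * Θ.entryProb (π s)
  else ∑ j, if Θ.IsService j s s' then Θ.μ j else 0

theorem entryProb_nonneg (a : ℝ) : 0 ≤ Θ.entryProb a :=
  sub_nonneg.2 (((monotone_cdf Θ.reservation).leftLim_le le_rfl).trans
    (cdf_le_one Θ.reservation a))

theorem rate_nonneg (s s' : Θ.State) : 0 ≤ Θ.rate π s s' := by
  unfold rate
  split_ifs
  · exact mul_nonneg Θ.lam_pos.le (Θ.entryProb_nonneg _)
  · exact Finset.sum_nonneg fun j _ => by
      split_ifs
      exacts [(Θ.μ_pos j).le, le_rfl]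

/-- The generator `Q^π` of the state process under the policy `π`. -/
def generator : Generator Θ.State where
  Q s s' := if s = s' then -∑ s'' ∈ Finset.univ.erase s, Θ.rate π s s'' else Θ.rate π s s'
  nonneg s s' h := by
    rw [if_neg h]
    exact Θ.rate_nonneg π s s'
  sum_zero s := by
    rw [← Finset.add_sum_erase Finset.univ _ (Finset.mem_univ s), if_pos rfl,
      neg_add_eq_zero]
    exact Finset.sum_congr rfl fun s' h => (if_neg (Finset.ne_of_mem_erase h).symm).symm

/-- The reward function `R^π`: the quoted price is earned when a customer enters. -/
def reward (s s' : Θ.State) : ℝ := if Θ.IsEntry s s' then (π s : ℝ) else 0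

/-- The expected revenue up to time `T` under the policy `π`, from the initial state `s₀`. -/
def expectedRevenue (s₀ : Θ.State) (T : ℝ≥0) : ℝ≥0∞ :=
  ∫⁻ ω, totalReward (Θ.reward π) (chainAt ω) T ∂((Θ.generator π).law s₀)

/-- `g` is the gain of the policy `π`: from every initial state the expected revenue up to any
time is finite, and the expected time-average revenue converges to `g`. -/
def IsGain (g : ℝ) : Prop :=
  ∀ s₀ : Θ.State, (∀ T, Θ.expectedRevenue π s₀ T ≠ ∞) ∧
    Tendsto (fun T : ℝ≥0 => (Θ.expectedRevenue π s₀ T).toReal / (T : ℝ)) atTop (𝓝 g)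

end TandemSystem

end

/-!
Let `h` be a bias of the policy and `g` its gain, that is, a solution of the Poisson equation
`r + Q h = g`, where `r s` is the rate at which revenue is earned in the state `s`. Dynkin's
formula reads `𝔼[revenue up to T] + 𝔼[h (X T)] = g T + h s₀`; as `h` is bounded on the finite state
space, dividing by `T` shows that the time average of the revenue tends to `g` from every initial
state. At a state where `h` is maximal `Q h` is at most `0`, so that `g ≤ r s` for some `s`; and
`r s` is `0` or `a λ (1 - F(a-))` for the price `a` quoted in `s`. The Poisson equation is solvable
because harmonic functions are constant by the same maximum principle, services leading from every
state to the empty line.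

Dynkin's formula is obtained by telescoping over the stages of the path. Applied to the holding
times as rewards, the same telescoping shows that a bounded time interval contains finitely many
jumps in expectation, so that the chain does not explode.
-/

theorem tendsto_toReal_div_coe_atTop {E : ℝ≥0 → ℝ≥0∞} {g C : ℝ≥0} (hle : ∀ T, E T ≤ g * T + C)
    (hge : ∀ T, g * T ≤ E T + C) :
    Tendsto (fun T : ℝ≥0 => (E T).toReal / (T : ℝ)) atTop (𝓝 g) := by
  have hdist (T : ℝ≥0) : |(E T).toReal - g * T| ≤ C := by
    have hfin : E T ≠ ∞ := ne_top_of_le_ne_top (by finiteness) (hle T)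
    have hle' := ENNReal.toReal_mono (by finiteness) (hle T)
    have hge' := ENNReal.toReal_mono (by finiteness) (hge T)
    rw [ENNReal.toReal_add (by finiteness) (by finiteness), ENNReal.toReal_mul] at hle'
    rw [ENNReal.toReal_add hfin (by finiteness), ENNReal.toReal_mul] at hge'
    simp only [ENNReal.coe_toReal] at hle' hge'
    exact abs_sub_le_iff.2 ⟨by linarith, by linarith⟩
  have hlim : Tendsto (fun T : ℝ≥0 => (C : ℝ) / T) atTop (𝓝 0) :=
    tendsto_const_nhds.div_atTop (NNReal.tendsto_coe_atTop.2 tendsto_id)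
  refine tendsto_iff_dist_tendsto_zero.2 (squeeze_zero' (.of_forall fun _ => dist_nonneg) ?_ hlim)
  filter_upwards [eventually_gt_atTop 0] with T hT
  have hT' : (0 : ℝ) < T := NNReal.coe_pos.2 hT
  rw [Real.dist_eq, div_sub' hT'.ne', abs_div, abs_of_pos hT', mul_comm (T : ℝ)]
  gcongr
  exact hdist T

section Exponential

variable {q t : ℝ}

theorem setLIntegral_Iic_expMeasure (hq : 0 ≤ q) (ht : 0 ≤ t) {f : ℝ → ℝ} (hf : Continuous f)
    (hf_nonneg : ∀ u ∈ Set.Icc 0 t, 0 ≤ f u) :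
    ∫⁻ u in Set.Iic t, ENNReal.ofReal (f u) ∂expMeasure q =
      ENNReal.ofReal (∫ u in 0..t, q * Real.exp (-(q * u)) * f u) := by
  have hcont : Continuous fun u => q * Real.exp (-(q * u)) * f u := by fun_prop
  have hdensity : (Set.Iic t).indicator (exponentialPDF q * fun u => ENNReal.ofReal (f u)) =
      (Set.Icc 0 t).indicator fun u => ENNReal.ofReal (q * Real.exp (-(q * u)) * f u) := by
    ext u
    by_cases hu : 0 ≤ u
    · simp only [Set.indicator_apply, Set.mem_Iic, Set.mem_Icc, hu, true_and, Pi.mul_apply,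
        exponentialPDF_of_nonneg hu, ← ENNReal.ofReal_mul (mul_nonneg hq (Real.exp_nonneg _))]
    · simp only [Set.indicator_apply, Set.mem_Icc, hu, false_and, if_false, Pi.mul_apply,
        exponentialPDF_of_neg (not_le.1 hu), zero_mul, ite_self]
  calc ∫⁻ u in Set.Iic t, ENNReal.ofReal (f u) ∂expMeasure q
      = ∫⁻ u in Set.Iic t, (exponentialPDF q * fun u => ENNReal.ofReal (f u)) u :=
        setLIntegral_withDensity_eq_setLIntegral_mul _
          (measurable_exponentialPDFReal q).ennreal_ofReal hf.measurable.ennreal_ofReal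
          measurableSet_Iic
    _ = ∫⁻ u in Set.Icc 0 t, ENNReal.ofReal (q * Real.exp (-(q * u)) * f u) := by
        rw [← lintegral_indicator measurableSet_Iic, hdensity,
          lintegral_indicator measurableSet_Icc]
    _ = ENNReal.ofReal (∫ u in Set.Icc 0 t, q * Real.exp (-(q * u)) * f u) :=
        (ofReal_integral_eq_lintegral_ofReal hcont.integrableOn_Icc
          ((ae_restrict_iff' measurableSet_Icc).2 (ae_of_all _ fun u hu =>
            mul_nonneg (mul_nonneg hq (Real.exp_nonneg _)) (hf_nonneg u hu)))).symm
    _ = _ := by rw [intervalIntegral.integral_of_le ht, integral_Icc_eq_integral_Ioc]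

/-- If every stage that ends by time `t` is credited with its mean duration `q⁻¹` and the rest of
the time with its length, then the expected credit is `t`. -/
theorem setLIntegral_Iic_expMeasure_inv_add_sub (hq : 0 < q) (ht : 0 ≤ t) :
    ∫⁻ u in Set.Iic t, ENNReal.ofReal (q⁻¹ + (t - u)) ∂expMeasure q = ENNReal.ofReal t := by
  have hderiv (u : ℝ) : HasDerivAt (fun u => -(Real.exp (-(q * u)) * (t - u)))
      (q * Real.exp (-(q * u)) * (q⁻¹ + (t - u))) u := by
    have hexp : HasDerivAt (fun u => Real.exp (-(q * u))) (Real.exp (-(q * u)) * -(q * 1)) u :=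
      ((hasDerivAt_id u).const_mul q).neg.exp
    convert! (hexp.mul ((hasDerivAt_id u).const_sub t)).neg using 1
    simp only [id_eq]
    field_simp
    ring
  have hcont : Continuous fun u => q * Real.exp (-(q * u)) * (q⁻¹ + (t - u)) := by fun_prop
  have hnonneg : ∀ u ∈ Set.Icc 0 t, 0 ≤ q⁻¹ + (t - u) := fun u hu =>
    add_nonneg (inv_nonneg.2 hq.le) (sub_nonneg.2 hu.2)
  rw [setLIntegral_Iic_expMeasure hq.le ht (by fun_prop) hnonneg,
    intervalIntegral.integral_eq_sub_of_hasDerivAt (fun u _ => hderiv u)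
      (hcont.intervalIntegrable 0 t)]
  simp

end Exponential

/-- The time at which stage `n` begins, the sum of the durations of the stages before it. -/
noncomputable def stageStart {S : Type} (ω : ℕ → S × ℝ) (n : ℕ) : ℝ :=
  ∑ k ∈ Finset.range n, (ω k).2

theorem stageStart_zero {S : Type} (ω : ℕ → S × ℝ) : stageStart ω 0 = 0 :=
  Finset.sum_range_zero _

theorem stageStart_succ {S : Type} (ω : ℕ → S × ℝ) (n : ℕ) :
    stageStart ω (n + 1) = stageStart ω n + (ω n).2 :=
  Finset.sum_range_succ _ _

theorem stageStart_succ_eq_sum_frestrictLe {S : Type} (ω : ℕ → S × ℝ) (n : ℕ) :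
    stageStart ω (n + 1) = ∑ k, (Preorder.frestrictLe (π := fun _ => S × ℝ) n ω k).2 := by
  rw [stageStart, Nat.range_succ_eq_Iic]
  exact (Finset.sum_coe_sort (Finset.Iic n) fun k => (ω k).2).symm

@[fun_prop]
theorem measurable_stageStart {S : Type} [MeasurableSpace S] (n : ℕ) :
    Measurable fun ω : ℕ → S × ℝ => stageStart ω n := by
  unfold stageStart
  fun_prop

theorem measurableSet_stageStart_le {S : Type} [MeasurableSpace S] (T : ℝ) (n : ℕ) :
    MeasurableSet {ω : ℕ → S × ℝ | stageStart ω n ≤ T} :=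
  measurableSet_le (measurable_stageStart n) measurable_const

theorem measurableSet_stageStart_le_lt {S : Type} [MeasurableSpace S] (T : ℝ) (n : ℕ) :
    MeasurableSet {ω : ℕ → S × ℝ | stageStart ω n ≤ T ∧ T < stageStart ω (n + 1)} :=
  (measurableSet_stageStart_le T n).inter
    (measurableSet_lt measurable_const (measurable_stageStart (n + 1)))

section Path

variable {S : Type} {ω : ℕ → S × ℝ}

theorem strictMono_stageStart (hpos : ∀ n, 0 < (ω n).2) : StrictMono (stageStart ω) :=
  strictMono_nat_of_lt_succ fun n =>
    (lt_add_of_pos_right _ (hpos n)).trans_eq (stageStart_succ ω n).symm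

theorem stageStart_nonneg (hpos : ∀ n, 0 < (ω n).2) (n : ℕ) : 0 ≤ stageStart ω n :=
  Finset.sum_nonneg fun k _ => (hpos k).le

theorem coe_toNNReal_stageStart (hpos : ∀ n, 0 < (ω n).2) (n : ℕ) :
    ((stageStart ω n).toNNReal : ℝ) = stageStart ω n :=
  Real.coe_toNNReal _ (stageStart_nonneg hpos n)

theorem chainAt_eq_of_mem_Ico (hpos : ∀ n, 0 < (ω n).2) {t : ℝ≥0} {n : ℕ}
    (ht : (t : ℝ) ∈ Set.Ico (stageStart ω n) (stageStart ω (n + 1))) :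
    chainAt ω t = (ω n).1 := by
  have hleast : IsLeast {m : ℕ | (t : ℝ) < stageStart ω (m + 1)} n :=
    ⟨ht.2, fun m hm => Nat.lt_succ_iff.1
      ((strictMono_stageStart hpos).lt_iff_lt.1 (ht.1.trans_lt hm))⟩
  exact congrArg (fun k => (ω k).1) hleast.csInf_eq

theorem chainAt_stageStart (hpos : ∀ n, 0 < (ω n).2) (n : ℕ) :
    chainAt ω (stageStart ω n).toNNReal = (ω n).1 := by
  refine chainAt_eq_of_mem_Ico hpos ?_
  rw [coe_toNNReal_stageStart hpos]
  exact ⟨le_rfl, strictMono_stageStart hpos n.lt_succ_self⟩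

theorem eventually_nhdsLT_chainAt_eq (hpos : ∀ n, 0 < (ω n).2) {t : ℝ≥0} {n : ℕ}
    (ht : (t : ℝ) ∈ Set.Ioc (stageStart ω n) (stageStart ω (n + 1))) :
    ∀ᶠ u in 𝓝[<] t, chainAt ω u = (ω n).1 := by
  have hlt : (stageStart ω n).toNNReal < t :=
    (Real.toNNReal_lt_iff_lt_coe (stageStart_nonneg hpos n)).2 ht.1
  filter_upwards [Ioo_mem_nhdsLT hlt] with u hu
  exact chainAt_eq_of_mem_Ico hpos
    ⟨Real.toNNReal_le_iff_le_coe.1 hu.1.le, (NNReal.coe_lt_coe.2 hu.2).trans_le ht.2⟩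

theorem exists_mem_Ico_stageStart (hunb : ∀ T, ∃ n, T < stageStart ω n) (t : ℝ≥0) :
    ∃ n, (t : ℝ) ∈ Set.Ico (stageStart ω n) (stageStart ω (n + 1)) := by
  classical
  have hfirst : Nat.find (hunb t) ≠ 0 := fun h0 =>
    t.coe_nonneg.not_gt (by simpa only [h0, stageStart_zero] using Nat.find_spec (hunb t))
  obtain ⟨n, hn⟩ := Nat.exists_eq_succ_of_ne_zero hfirst
  exact ⟨n, not_lt.1 (Nat.find_min (hunb t) (by omega)),
    by simpa only [hn] using Nat.find_spec (hunb t)⟩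

/-- The sequence of stages of a nonexplosive path that changes its state at the end of every
stage. Almost every path of a chain without absorbing states is of this kind. -/
structure IsJumpPath (ω : ℕ → S × ℝ) : Prop where
  hold_pos : ∀ n, 0 < (ω n).2
  state_ne : ∀ n, (ω (n + 1)).1 ≠ (ω n).1
  exists_lt : ∀ T, ∃ n, T < stageStart ω n

namespace IsJumpPath

theorem changesAt_of_eq_stageStart (h : IsJumpPath ω) {t : ℝ≥0} {n : ℕ}
    (ht : (t : ℝ) = stageStart ω (n + 1)) : ChangesAt (chainAt ω) t := by
  intro hconst
  have hmono := strictMono_stageStart h.hold_pos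
  have hbefore : ∀ᶠ u in 𝓝[<] t, chainAt ω u = (ω n).1 :=
    eventually_nhdsLT_chainAt_eq h.hold_pos ⟨ht ▸ hmono n.lt_succ_self, ht.le⟩
  have hat : chainAt ω t = (ω (n + 1)).1 :=
    chainAt_eq_of_mem_Ico h.hold_pos ⟨ht.ge, ht ▸ hmono (n + 1).lt_succ_self⟩
  have htpos : 0 < t := by
    rw [← NNReal.coe_pos, ht]
    exact (stageStart_nonneg h.hold_pos n).trans_lt (hmono n.lt_succ_self)
  have : (𝓝[<] t).NeBot := nhdsLT_neBot_of_exists_lt ⟨0, htpos⟩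
  obtain ⟨u, hu, hut⟩ := (hbefore.and hconst).exists
  exact h.state_ne n (hat.symm.trans (hut.symm.trans hu))

theorem changesAt_iff (h : IsJumpPath ω) (t : ℝ≥0) :
    ChangesAt (chainAt ω) t ↔ ∃ n, (t : ℝ) = stageStart ω (n + 1) := by
  refine ⟨fun hchange => ?_, fun ⟨n, hn⟩ => h.changesAt_of_eq_stageStart hn⟩
  obtain ⟨n, hle, hlt⟩ := exists_mem_Ico_stageStart h.exists_lt t
  rcases hle.eq_or_lt with heq | hlt'
  · cases n with
    | zero =>
      obtain rfl : t = 0 := NNReal.coe_eq_zero.1 (heq.symm.trans (stageStart_zero ω))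
      refine absurd ?_ hchange
      simp only [← bot_eq_zero', Set.Iio_bot, nhdsWithin_empty, eventually_bot]
    | succ n => exact ⟨n, heq.symm⟩
  · refine absurd ?_ hchange
    rw [chainAt_eq_of_mem_Ico h.hold_pos ⟨hle, hlt⟩]
    exact eventually_nhdsLT_chainAt_eq h.hold_pos ⟨hlt', hlt.le⟩

theorem changeTime_eq (h : IsJumpPath ω) (n : ℕ) :
    changeTime (chainAt ω) n = ENNReal.ofReal (stageStart ω n) := by
  have hmono := strictMono_stageStart h.hold_pos
  have hlt_iff : ∀ k m, ENNReal.ofReal (stageStart ω k) < ENNReal.ofReal (stageStart ω m) ↔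
      k < m := fun k m => by
    rw [ENNReal.ofReal_lt_ofReal_iff_of_nonneg (stageStart_nonneg h.hold_pos k), hmono.lt_iff_lt]
  induction n with
  | zero => rw [stageStart_zero, ENNReal.ofReal_zero, changeTime]
  | succ n ih =>
    rw [changeTime, ih]
    refine IsLeast.csInf_eq ⟨⟨(stageStart ω (n + 1)).toNNReal, ⟨?_, ?_⟩, rfl⟩, ?_⟩
    · exact (hlt_iff n (n + 1)).2 n.lt_succ_self
    · exact h.changesAt_of_eq_stageStart (coe_toNNReal_stageStart h.hold_pos _)
    · rintro _ ⟨t, ⟨hlt, hchange⟩, rfl⟩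
      obtain ⟨m, hm⟩ := (h.changesAt_iff t).1 hchange
      have ht : (t : ℝ≥0∞) = ENNReal.ofReal (stageStart ω (m + 1)) := by
        rw [← hm, ENNReal.ofReal_coe_nnreal]
      rw [ht, hlt_iff] at hlt
      exact (ENNReal.ofReal_le_ofReal (hmono.monotone hlt)).trans_eq ht.symm

theorem totalReward_eq (h : IsJumpPath ω) (R : S → S → ℝ) (T : ℝ≥0) :
    totalReward R (chainAt ω) T = ∑' n, {ω : ℕ → S × ℝ | stageStart ω (n + 1) ≤ T}.indicator
      (fun ω => ENNReal.ofReal (R (ω n).1 (ω (n + 1)).1)) ω := by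
  have hchain : ∀ n, chainAt ω (changeTime (chainAt ω) n).toNNReal = (ω n).1 := fun n => by
    rw [h.changeTime_eq]
    exact chainAt_stageStart h.hold_pos n
  have htime : ∀ n, changeTime (chainAt ω) n ≤ T ↔ stageStart ω n ≤ T := fun n => by
    rw [h.changeTime_eq, ← ENNReal.ofReal_coe_nnreal, ENNReal.ofReal_le_ofReal_iff T.coe_nonneg]
  simp only [totalReward, hchain, htime, Set.indicator_apply, Set.mem_ofPred_eq]

theorem apply_chainAt_eq (h : IsJumpPath ω) (f : S → ℝ≥0∞) (t : ℝ≥0) :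
    f (chainAt ω t) =
      ∑' n, {ω : ℕ → S × ℝ | stageStart ω n ≤ t ∧ t < stageStart ω (n + 1)}.indicator
        (fun ω => f (ω n).1) ω := by
  have hmono := strictMono_stageStart h.hold_pos
  obtain ⟨n, hle, hlt⟩ := exists_mem_Ico_stageStart h.exists_lt t
  have hother : ∀ m ≠ n, ω ∉ {ω | stageStart ω m ≤ t ∧ t < stageStart ω (m + 1)} :=
    fun m hm hmem => hm ((Nat.lt_succ_iff.1 (hmono.lt_iff_lt.1 (hmem.1.trans_lt hlt))).antisymm
      (Nat.lt_succ_iff.1 (hmono.lt_iff_lt.1 (hle.trans_lt hmem.2))))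
  have hcurrent : ω ∈ {ω : ℕ → S × ℝ | stageStart ω n ≤ t ∧ t < stageStart ω (n + 1)} :=
    ⟨hle, hlt⟩
  rw [tsum_eq_single n fun m hm => Set.indicator_of_notMem (hother m hm) _,
    Set.indicator_of_mem hcurrent, chainAt_eq_of_mem_Ico h.hold_pos ⟨hle, hlt⟩]

end IsJumpPath

end Path

namespace Generator

section Law

variable {S : Type} [Fintype S]

theorem ae_holdLaw_pos (G : Generator S) (s : S) : ∀ᵐ u ∂G.holdLaw s, 0 < u := by
  unfold holdLaw
  split_ifs
  · have hIio : expMeasure (G.exitRate s) (Set.Iio 0) = 0 :=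
      (withDensity_apply _ measurableSet_Iio).trans (lintegral_gammaPDF_of_nonpos le_rfl)
    have hIic : expMeasure (G.exitRate s) (Set.Iic 0) = 0 := by
      rw [← hIio]
      exact measure_congr ((withDensity_absolutelyContinuous volume _).ae_le Iio_ae_eq_Iic.symm)
    filter_upwards [compl_mem_ae_iff.2 hIic] with u hu using not_le.1 hu
  · exact (ae_dirac_iff measurableSet_Ioi).2 one_pos

variable [MeasurableSpace S] [DiscreteMeasurableSpace S]

theorem lintegral_stageKernel (G : Generator S) (s : S) {f : S × ℝ → ℝ≥0∞} (hf : Measurable f) :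
    ∫⁻ x, f x ∂G.stageKernel s = ∫⁻ u, f (s, u) ∂G.holdLaw s := by
  change ∫⁻ x, f x ∂((Measure.dirac s).prod (G.holdLaw s)) = _
  rw [lintegral_prod _ hf.aemeasurable, lintegral_dirac]

theorem lintegral_stageKernel_eq_lintegral_holdLaw (G : Generator S) (s : S)
    {f : S × ℝ → ℝ≥0∞} (hf : Measurable f) :
    ∫⁻ x, f x ∂G.stageKernel s = ∫⁻ x, ∫⁻ u, f (x.1, u) ∂G.holdLaw x.1 ∂G.stageKernel s := by
  have hhold : Measurable fun x : S × ℝ => ∫⁻ u, f (x.1, u) ∂G.holdLaw x.1 :=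
    (Measurable.of_discrete (f := fun s => ∫⁻ u, f (s, u) ∂G.holdLaw s)).comp measurable_fst
  rw [G.lintegral_stageKernel s hf, G.lintegral_stageKernel s hhold]
  simp only [lintegral_const, measure_univ, mul_one]

theorem measurable_lintegral_holdLaw (G : Generator S) {f : ℝ × S × ℝ → ℝ≥0∞}
    (hf : Measurable f) :
    Measurable fun p : ℝ × S × ℝ => ∫⁻ u, f (p.1, p.2.1, u) ∂G.holdLaw p.2.1 := by
  have hsection : ∀ s, Measurable fun t => ∫⁻ u, f (t, s, u) ∂G.holdLaw s := fun s =>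
    Measurable.lintegral_prod_right' (f := fun q : ℝ × ℝ => f (q.1, s, q.2))
      (hf.comp (by fun_prop))
  have hjoint : Measurable fun p : ℝ × S => ∫⁻ u, f (p.1, p.2, u) ∂G.holdLaw p.2 :=
    measurable_from_prod_countable_left hsection
  exact hjoint.comp (g := fun p => _) (f := fun p : ℝ × S × ℝ => (p.1, p.2.1)) (by fun_prop)

variable [DecidableEq S]

theorem lintegral_jumpLaw (G : Generator S) {s : S} (hs : 0 < G.exitRate s) (f : S → ℝ≥0∞) :
    ∫⁻ x, f x ∂G.jumpLaw s =
      ∑ s' ∈ Finset.univ.erase s, ENNReal.ofReal (G.Q s s' / G.exitRate s) * f s' := by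
  simp only [jumpLaw, if_pos hs, lintegral_finsetSum_measure, lintegral_smul_measure,
    lintegral_dirac, smul_eq_mul]

theorem ae_jumpLaw_ne (G : Generator S) {s : S} (hs : 0 < G.exitRate s) :
    ∀ᵐ s' ∂G.jumpLaw s, s' ≠ s := by
  have hself : G.jumpLaw s {s} = 0 := by
    rw [← lintegral_indicator_one (measurableSet_singleton s), G.lintegral_jumpLaw hs]
    refine Finset.sum_eq_zero fun s' hs' => ?_
    simp only [Set.indicator_of_notMem (s := {s}) (Finset.ne_of_mem_erase hs'), mul_zero]
  exact compl_mem_ae_iff.2 hself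

instance isProbabilityMeasure_law (G : Generator S) (s₀ : S) :
    IsProbabilityMeasure (G.law s₀) :=
  inferInstanceAs (IsProbabilityMeasure (Kernel.trajMeasure _ _))

theorem map_law_zero (G : Generator S) (s₀ : S) :
    (G.law s₀).map (fun ω => ω 0) = G.stageKernel s₀ := by
  have hcomp : (fun ω : ℕ → S × ℝ => ω 0) =
      (fun x => x ⟨0, Finset.mem_Iic.2 le_rfl⟩) ∘ Preorder.frestrictLe (π := fun _ => S × ℝ) 0 :=
    rfl
  unfold law Kernel.trajMeasure
  rw [hcomp, ← Measure.map_map (by fun_prop) (by fun_prop), Measure.map_comp _ _ (by fun_prop),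
    Kernel.traj_map_frestrictLe, Kernel.partialTraj_self, Measure.id_comp,
    Measure.map_map (by fun_prop) (by fun_prop)]
  exact Measure.map_id

theorem lintegral_law_zero (G : Generator S) (s₀ : S) {f : S × ℝ → ℝ≥0∞} (hf : Measurable f) :
    ∫⁻ ω, f (ω 0) ∂G.law s₀ = ∫⁻ x, f x ∂G.stageKernel s₀ := by
  rw [← G.map_law_zero s₀, lintegral_map hf (measurable_pi_apply 0)]

theorem lintegral_law_succ (G : Generator S) (s₀ : S) (n : ℕ)
    {f : ((_ : Finset.Iic n) → S × ℝ) × (S × ℝ) → ℝ≥0∞} (hf : Measurable f) :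
    ∫⁻ ω, f (Preorder.frestrictLe n ω, ω (n + 1)) ∂G.law s₀ =
      ∫⁻ ω, ∫⁻ s', ∫⁻ x, f (Preorder.frestrictLe n ω, x) ∂G.stageKernel s' ∂G.jumpLaw (ω n).1
        ∂G.law s₀ := by
  have hmarkov : (G.law s₀).map (Preorder.frestrictLe n) ⊗ₘ G.step n =
      (G.law s₀).map fun ω => (Preorder.frestrictLe n ω, ω (n + 1)) :=
    Kernel.map_frestrictLe_trajMeasure_compProd_eq_map_trajMeasure (X := fun _ => S × ℝ)
  rw [← lintegral_map hf (by fun_prop), ← hmarkov, Measure.lintegral_compProd hf,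
    lintegral_map hf.lintegral_kernel_prod_right' (by fun_prop)]
  refine lintegral_congr fun ω => ?_
  have hf' : Measurable fun x => f (Preorder.frestrictLe (π := fun _ => S × ℝ) n ω, x) :=
    hf.comp (by fun_prop)
  unfold step
  rw [Kernel.comap_apply, Kernel.lintegral_comp _ _ _ hf']
  rfl

theorem lintegral_law_stage (G : Generator S) (s₀ : S) (n : ℕ) {f : ℝ × S × ℝ → ℝ≥0∞}
    (hf : Measurable f) :
    ∫⁻ ω, f (stageStart ω n, ω n) ∂G.law s₀ =
      ∫⁻ ω, ∫⁻ u, f (stageStart ω n, (ω n).1, u) ∂G.holdLaw (ω n).1 ∂G.law s₀ := by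
  have hhold := G.measurable_lintegral_holdLaw hf
  have hsection : ∀ t, Measurable fun x => f (t, x) := fun t => hf.comp measurable_prodMk_left
  cases n with
  | zero =>
    simp only [stageStart_zero]
    rw [G.lintegral_law_zero s₀ (hsection 0),
      G.lintegral_law_zero s₀ (f := fun x => ∫⁻ u, f (0, x.1, u) ∂G.holdLaw x.1)
        (hhold.comp measurable_prodMk_left),
      G.lintegral_stageKernel_eq_lintegral_holdLaw s₀ (hsection 0)]
  | succ n =>
    simp only [stageStart_succ_eq_sum_frestrictLe]
    rw [G.lintegral_law_succ s₀ n (f := fun p => f (∑ k, (p.1 k).2, p.2)) (hf.comp (by fun_prop)),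
      G.lintegral_law_succ s₀ n
        (f := fun p => ∫⁻ u, f (∑ k, (p.1 k).2, p.2.1, u) ∂G.holdLaw p.2.1)
        (hhold.comp (f := fun p : (Finset.Iic n → S × ℝ) × (S × ℝ) => (∑ k, (p.1 k).2, p.2))
          (by fun_prop))]
    refine lintegral_congr fun ω => lintegral_congr fun s => ?_
    exact G.lintegral_stageKernel_eq_lintegral_holdLaw s
      (hsection (∑ k : Finset.Iic n, (ω k).2))

theorem lintegral_law_transition (G : Generator S) (s₀ : S) (n : ℕ)
    {f : (ℝ × S × ℝ) × S → ℝ≥0∞} (hf : Measurable f) :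
    ∫⁻ ω, f ((stageStart ω n, ω n), (ω (n + 1)).1) ∂G.law s₀ =
      ∫⁻ ω, ∫⁻ u, ∫⁻ s', f ((stageStart ω n, (ω n).1, u), s') ∂G.jumpLaw (ω n).1
        ∂G.holdLaw (ω n).1 ∂G.law s₀ := by
  have hjump : Measurable fun p : ℝ × S × ℝ => ∫⁻ s', f (p, s') ∂G.jumpLaw p.2.1 :=
    hf.lintegral_kernel_prod_right'
      (κ := G.jumpKernel.comap (fun p : ℝ × S × ℝ => p.2.1) (by fun_prop))
  let last : Finset.Iic n := ⟨n, Finset.mem_Iic.2 le_rfl⟩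
  let start (h : Finset.Iic n → S × ℝ) : ℝ := ∑ k, (h k).2 - (h last).2
  have hstart : ∀ ω, start (Preorder.frestrictLe n ω) = stageStart ω n := fun ω => by
    rw [sub_eq_iff_eq_add, ← stageStart_succ_eq_sum_frestrictLe, stageStart_succ]
    rfl
  calc ∫⁻ ω, f ((stageStart ω n, ω n), (ω (n + 1)).1) ∂G.law s₀
      = ∫⁻ ω, ∫⁻ s', ∫⁻ x, f ((stageStart ω n, ω n), x.1) ∂G.stageKernel s'
          ∂G.jumpLaw (ω n).1 ∂G.law s₀ := by
        simp only [← hstart]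
        exact G.lintegral_law_succ s₀ n (f := fun p => f ((start p.1, p.1 last), p.2.1))
          (hf.comp (by fun_prop))
    _ = ∫⁻ ω, ∫⁻ s', f ((stageStart ω n, ω n), s') ∂G.jumpLaw (ω n).1 ∂G.law s₀ := by
        refine lintegral_congr fun ω => lintegral_congr fun s' => ?_
        rw [G.lintegral_stageKernel s' (f := fun x => f ((stageStart ω n, ω n), x.1))
          (hf.comp (by fun_prop))]
        simp only [lintegral_const, measure_univ, mul_one]
    _ = _ := G.lintegral_law_stage s₀ n hjump

theorem ae_law_transition (G : Generator S) (s₀ : S) {p : (S × ℝ) × S → Prop}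
    (hp : MeasurableSet {x | p x})
    (h : ∀ s, ∀ᵐ u ∂G.holdLaw s, ∀ᵐ s' ∂G.jumpLaw s, p ((s, u), s')) :
    ∀ᵐ ω ∂G.law s₀, ∀ n, p (ω n, (ω (n + 1)).1) := by
  refine ae_all_iff.2 fun n => ?_
  let f : (ℝ × S × ℝ) × S → ℝ≥0∞ := fun x => {x | p x}ᶜ.indicator 1 (x.1.2, x.2)
  have hf : Measurable f := (measurable_one.indicator hp.compl).comp (by fun_prop)
  have hzero : ∫⁻ ω, f ((stageStart ω n, ω n), (ω (n + 1)).1) ∂G.law s₀ = 0 := by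
    rw [G.lintegral_law_transition s₀ n hf]
    refine lintegral_eq_zero_of_ae_eq_zero (ae_of_all _ fun ω => ?_)
    refine lintegral_eq_zero_of_ae_eq_zero ?_
    filter_upwards [h (ω n).1] with u hu
    refine lintegral_eq_zero_of_ae_eq_zero ?_
    filter_upwards [hu] with s' hs'
    exact Set.indicator_of_notMem (not_not_intro hs') _
  have hmeas : Measurable fun ω : ℕ → S × ℝ => f ((stageStart ω n, ω n), (ω (n + 1)).1) :=
    hf.comp (by fun_prop)
  filter_upwards [(lintegral_eq_zero_iff hmeas).1 hzero] with ω hω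
  by_contra hnot
  have hone : f ((stageStart ω n, ω n), (ω (n + 1)).1) = 1 := Set.indicator_of_mem hnot 1
  exact one_ne_zero (hone.symm.trans hω)

end Law

section EmbeddedChain

variable {S : Type} [Fintype S] [DecidableEq S] [MeasurableSpace S]

/-- The Poisson equation of the embedded jump chain: `h` is a relative value function (bias) for
the gain `g` when the transition from `s` to `s'` is rewarded with `R s s'`. The mean duration of
a stage in the state `s` is `(exitRate s)⁻¹`. -/
def IsBias (G : Generator S) (R : S → S → ℝ≥0∞) (g : ℝ≥0∞) (h : S → ℝ≥0∞) : Prop :=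
  ∀ s, ∫⁻ s', (R s s' + h s') ∂G.jumpLaw s = g * ENNReal.ofReal (G.exitRate s)⁻¹ + h s

variable {G : Generator S} {R : S → S → ℝ≥0∞} {g : ℝ≥0∞} {h : S → ℝ≥0∞}

theorem IsBias.lintegral_transition (hb : G.IsBias R g h) {s : S} (hs : 0 < G.exitRate s) (t : ℝ) :
    ∫⁻ u, ∫⁻ s', (if u ≤ t then R s s' + (g * ENNReal.ofReal (t - u) + h s')
      else if 0 ≤ t then h s else 0) ∂G.jumpLaw s ∂G.holdLaw s =
      if 0 ≤ t then g * ENNReal.ofReal t + h s else 0 := by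
  rcases lt_or_ge t 0 with ht | ht
  · simp only [if_neg ht.not_ge]
    refine lintegral_eq_zero_of_ae_eq_zero ?_
    filter_upwards [G.ae_holdLaw_pos s] with u hu
    simp only [if_neg (ht.trans hu).not_ge, lintegral_zero, Pi.zero_apply]
  have hjump (u : ℝ) : ∫⁻ s', (if u ≤ t then R s s' + (g * ENNReal.ofReal (t - u) + h s')
      else h s) ∂G.jumpLaw s = (Set.Iic t).indicator
        (fun u => g * ENNReal.ofReal ((G.exitRate s)⁻¹ + (t - u))) u + h s := by
    by_cases hu : u ≤ t
    · simp only [if_pos hu, add_left_comm (R s _), Set.indicator_of_mem (Set.mem_Iic.2 hu)]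
      rw [lintegral_add_left (f := fun _ => g * ENNReal.ofReal (t - u)) measurable_const,
        lintegral_const, measure_univ, mul_one, hb s,
        ENNReal.ofReal_add (inv_nonneg.2 hs.le) (sub_nonneg.2 hu)]
      ring
    · simp only [if_neg hu, lintegral_const, measure_univ, mul_one,
        Set.indicator_of_notMem (Set.notMem_Iic.2 (not_le.1 hu)), zero_add]
  have hhold : ∫⁻ u in Set.Iic t, ENNReal.ofReal ((G.exitRate s)⁻¹ + (t - u)) ∂G.holdLaw s =
      ENNReal.ofReal t := by
    rw [holdLaw, if_pos hs, setLIntegral_Iic_expMeasure_inv_add_sub hs ht]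
  simp only [if_pos ht, hjump]
  rw [lintegral_add_right _ measurable_const, lintegral_indicator measurableSet_Iic,
    lintegral_const_mul _ (by fun_prop), hhold, lintegral_const, measure_univ, mul_one]

end EmbeddedChain

section Dynkin

variable {S : Type} [Fintype S] [DecidableEq S] [MeasurableSpace S] [DiscreteMeasurableSpace S]

/-- The expected reward of the transition after stage `n`, counted if it occurs by time `T`. -/
noncomputable def transitionReward (G : Generator S) (s₀ : S) (T : ℝ) (R : S → S → ℝ≥0∞)
    (n : ℕ) : ℝ≥0∞ :=
  ∫⁻ ω in {ω | stageStart ω (n + 1) ≤ T}, R (ω n).1 (ω (n + 1)).1 ∂G.law s₀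

/-- The value `g * (T - t) + h s` ascribed to the state `s` in which stage `n` begins at the
time `t`, on average over the paths for which `t ≤ T`. -/
noncomputable def stageValue (G : Generator S) (s₀ : S) (T : ℝ) (g : ℝ≥0∞) (h : S → ℝ≥0∞)
    (n : ℕ) : ℝ≥0∞ :=
  ∫⁻ ω in {ω | stageStart ω n ≤ T}, (g * ENNReal.ofReal (T - stageStart ω n) + h (ω n).1)
    ∂G.law s₀

/-- The value `h s` of the state `s` at time `T`, on average over the paths that are in stage `n`
at that time. -/
noncomputable def currentValue (G : Generator S) (s₀ : S) (T : ℝ) (h : S → ℝ≥0∞) (n : ℕ) :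
    ℝ≥0∞ :=
  ∫⁻ ω in {ω | stageStart ω n ≤ T ∧ T < stageStart ω (n + 1)}, h (ω n).1 ∂G.law s₀

section Balance

variable {G : Generator S} {R : S → S → ℝ≥0∞} {g : ℝ≥0∞} {h : S → ℝ≥0∞}

/-- Replacing the value of stage `n` by what is known at its end does not change the
expectation. -/
theorem IsBias.transitionReward_add_currentValue_add_stageValue (hb : G.IsBias R g h)
    (hG : ∀ s, 0 < G.exitRate s) (s₀ : S) (T : ℝ) (n : ℕ) :
    G.transitionReward s₀ T R n + G.currentValue s₀ T h n + G.stageValue s₀ T g h (n + 1) =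
      G.stageValue s₀ T g h n := by
  have hR : Measurable fun p : S × S => R p.1 p.2 := .of_discrete
  have hh : Measurable h := .of_discrete
  let f : (ℝ × S × ℝ) × S → ℝ≥0∞ := fun x =>
    if x.1.2.2 ≤ T - x.1.1 then
      R x.1.2.1 x.2 + (g * ENNReal.ofReal (T - x.1.1 - x.1.2.2) + h x.2)
    else if 0 ≤ T - x.1.1 then h x.1.2.1 else 0
  have hf : Measurable f := by
    refine Measurable.ite (measurableSet_le (by fun_prop) (by fun_prop)) ?_
      (Measurable.ite (measurableSet_le (by fun_prop) (by fun_prop)) (by fun_prop) (by fun_prop))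
    exact (hR.comp (f := fun x : (ℝ × S × ℝ) × S => (x.1.2.1, x.2)) (by fun_prop)).add
      (by fun_prop)
  calc G.transitionReward s₀ T R n + G.currentValue s₀ T h n + G.stageValue s₀ T g h (n + 1)
      = ∫⁻ ω, f ((stageStart ω n, ω n), (ω (n + 1)).1) ∂G.law s₀ := by
        have hbefore := measurableSet_stageStart_le (S := S) T (n + 1)
        have hduring := measurableSet_stageStart_le_lt (S := S) T n
        rw [transitionReward, currentValue, stageValue, ← lintegral_indicator hbefore,
          ← lintegral_indicator hduring, ← lintegral_indicator hbefore,
          ← lintegral_add_right _ (Measurable.indicator (by fun_prop) hduring),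
          ← lintegral_add_right _ (Measurable.indicator (by fun_prop) hbefore)]
        refine lintegral_congr fun ω => ?_
        have hend : (ω n).2 ≤ T - stageStart ω n ↔ stageStart ω (n + 1) ≤ T := by
          rw [stageStart_succ, le_sub_iff_add_le']
        have hrest : T - stageStart ω n - (ω n).2 = T - stageStart ω (n + 1) := by
          rw [stageStart_succ, sub_sub]
        simp only [f, hend, hrest, sub_nonneg, Set.indicator_apply, Set.mem_ofPred_eq, ← not_le]
        split_ifs <;> simp_all
    _ = ∫⁻ ω, (if 0 ≤ T - stageStart ω n then
          g * ENNReal.ofReal (T - stageStart ω n) + h (ω n).1 else 0) ∂G.law s₀ := by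
        rw [G.lintegral_law_transition s₀ n hf]
        exact lintegral_congr fun ω => hb.lintegral_transition (hG (ω n).1) (T - stageStart ω n)
    _ = G.stageValue s₀ T g h n := by
        rw [stageValue, ← lintegral_indicator (measurableSet_stageStart_le T n)]
        simp only [sub_nonneg, Set.indicator_apply, Set.mem_ofPred_eq]

theorem stageValue_zero (G : Generator S) (s₀ : S) {T : ℝ} (hT : 0 ≤ T) (g : ℝ≥0∞)
    (h : S → ℝ≥0∞) : G.stageValue s₀ T g h 0 = g * ENNReal.ofReal T + h s₀ := by
  have hmeas : Measurable fun x : S × ℝ => g * ENNReal.ofReal T + h x.1 :=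
    measurable_const.add ((Measurable.of_discrete (f := h)).comp measurable_fst)
  simp only [stageValue, stageStart_zero, hT, sub_zero, Set.ofPred_true, Measure.restrict_univ]
  rw [G.lintegral_law_zero s₀ hmeas, G.lintegral_stageKernel s₀ hmeas]
  simp only [lintegral_const, measure_univ, mul_one]

theorem IsBias.sum_add_stageValue (hb : G.IsBias R g h) (hG : ∀ s, 0 < G.exitRate s) (s₀ : S)
    {T : ℝ} (hT : 0 ≤ T) (n : ℕ) :
    ∑ k ∈ Finset.range n, (G.transitionReward s₀ T R k + G.currentValue s₀ T h k) +
      G.stageValue s₀ T g h n = g * ENNReal.ofReal T + h s₀ := by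
  induction n with
  | zero => rw [Finset.sum_range_zero, zero_add, G.stageValue_zero s₀ hT]
  | succ n ih =>
    rw [Finset.sum_range_succ, add_assoc,
      hb.transitionReward_add_currentValue_add_stageValue hG, ih]

theorem IsBias.tsum_transitionReward_le (hb : G.IsBias R g h) (hG : ∀ s, 0 < G.exitRate s)
    (s₀ : S) {T : ℝ} (hT : 0 ≤ T) :
    ∑' n, G.transitionReward s₀ T R n ≤ g * ENNReal.ofReal T + h s₀ := by
  refine ENNReal.tsum_le_of_sum_range_le fun n => ?_
  rw [← hb.sum_add_stageValue hG s₀ hT n]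
  exact (Finset.sum_le_sum fun k _ => le_self_add).trans le_self_add

end Balance

theorem ae_hold_pos (G : Generator S) (s₀ : S) : ∀ᵐ ω ∂G.law s₀, ∀ n, 0 < (ω n).2 :=
  G.ae_law_transition s₀ (p := fun x => 0 < x.1.2)
    (measurableSet_lt measurable_const (by fun_prop)) fun s => by
      filter_upwards [G.ae_holdLaw_pos s] with u hu using ae_of_all _ fun _ => hu

theorem ae_state_ne (G : Generator S) (hG : ∀ s, 0 < G.exitRate s) (s₀ : S) :
    ∀ᵐ ω ∂G.law s₀, ∀ n, (ω (n + 1)).1 ≠ (ω n).1 :=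
  G.ae_law_transition s₀ (p := fun x => x.2 ≠ x.1.1)
    (measurableSet_eq_fun (by fun_prop) (by fun_prop)).compl fun s =>
      ae_of_all _ fun _ => G.ae_jumpLaw_ne (hG s)

theorem tsum_law_stageStart_le_ne_top (G : Generator S) (hG : ∀ s, 0 < G.exitRate s) (s₀ : S)
    {T : ℝ} (hT : 0 ≤ T) :
    ∑' n, G.law s₀ {ω | stageStart ω (n + 1) ≤ T} ≠ ∞ := by
  have : Nonempty S := ⟨s₀⟩
  obtain ⟨fastest, hfastest⟩ := Finite.exists_max G.exitRate
  have hb : G.IsBias (fun s _ => ENNReal.ofReal (G.exitRate s)⁻¹) 1 0 := fun s => by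
    simp only [Pi.zero_apply, add_zero, lintegral_const, measure_univ, mul_one, one_mul]
  have hterm (n : ℕ) : ENNReal.ofReal (G.exitRate fastest)⁻¹ *
      G.law s₀ {ω | stageStart ω (n + 1) ≤ T} ≤
      G.transitionReward s₀ T (fun s _ => ENNReal.ofReal (G.exitRate s)⁻¹) n := by
    rw [← setLIntegral_const]
    exact lintegral_mono fun ω => ENNReal.ofReal_le_ofReal (inv_anti₀ (hG _) (hfastest _))
  have hle := (ENNReal.tsum_le_tsum hterm).trans (hb.tsum_transitionReward_le hG s₀ hT)
  rw [ENNReal.tsum_mul_left, one_mul, Pi.zero_apply, add_zero] at hle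
  have hrate : ENNReal.ofReal (G.exitRate fastest)⁻¹ ≠ 0 :=
    (ENNReal.ofReal_pos.2 (inv_pos.2 (hG fastest))).ne'
  exact (ENNReal.lt_top_of_mul_ne_top_right (ne_top_of_le_ne_top ENNReal.ofReal_ne_top hle)
    hrate).ne

theorem ae_exists_lt_stageStart (G : Generator S) (hG : ∀ s, 0 < G.exitRate s) (s₀ : S) :
    ∀ᵐ ω ∂G.law s₀, ∀ T, ∃ n, T < stageStart ω n := by
  have hnat : ∀ᵐ ω ∂G.law s₀, ∀ m : ℕ, ∃ n, (m : ℝ) < stageStart ω n := by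
    refine ae_all_iff.2 fun m => ?_
    filter_upwards [ae_eventually_notMem (G.tsum_law_stageStart_le_ne_top hG s₀ m.cast_nonneg)]
      with ω hω
    obtain ⟨n, hn⟩ := hω.exists
    exact ⟨n + 1, not_le.1 hn⟩
  filter_upwards [hnat] with ω hω T
  obtain ⟨m, hm⟩ := exists_nat_ge T
  obtain ⟨n, hn⟩ := hω m
  exact ⟨n, hm.trans_lt hn⟩

theorem ae_isJumpPath (G : Generator S) (hG : ∀ s, 0 < G.exitRate s) (s₀ : S) :
    ∀ᵐ ω ∂G.law s₀, IsJumpPath ω := by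
  filter_upwards [G.ae_hold_pos s₀, G.ae_state_ne hG s₀, G.ae_exists_lt_stageStart hG s₀]
    with ω hpos hne hunb using ⟨hpos, hne, hunb⟩

theorem tendsto_stageValue_zero (G : Generator S) (hG : ∀ s, 0 < G.exitRate s) (s₀ : S)
    {g : ℝ≥0∞} (hg : g ≠ ∞) {h : S → ℝ≥0∞} (hh : ∀ s, h s ≠ ∞) {T : ℝ} (hT : 0 ≤ T) :
    Tendsto (G.stageValue s₀ T g h) atTop (𝓝 0) := by
  have : Nonempty S := ⟨s₀⟩
  obtain ⟨best, hbest⟩ := Finite.exists_max h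
  have hbound : g * ENNReal.ofReal T + h best ≠ ∞ :=
    ENNReal.add_ne_top.2 ⟨ENNReal.mul_ne_top hg ENNReal.ofReal_ne_top, hh best⟩
  have hle (n : ℕ) : G.stageValue s₀ T g h (n + 1) ≤
      (g * ENNReal.ofReal T + h best) * G.law s₀ {ω | stageStart ω (n + 1) ≤ T} := by
    rw [← setLIntegral_const]
    refine lintegral_mono_ae (ae_restrict_of_ae ?_)
    filter_upwards [G.ae_hold_pos s₀] with ω hpos
    gcongr
    exacts [sub_le_self T (stageStart_nonneg hpos _), hbest _]
  have hlim := ENNReal.Tendsto.const_mul (ENNReal.tendsto_atTop_zero_of_tsum_ne_top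
    (G.tsum_law_stageStart_le_ne_top hG s₀ hT)) (Or.inr hbound)
  rw [mul_zero] at hlim
  exact (tendsto_add_atTop_iff_nat 1).1
    (tendsto_of_tendsto_of_tendsto_of_le_of_le tendsto_const_nhds hlim (fun _ => zero_le) hle)

theorem lintegral_totalReward (G : Generator S) (hG : ∀ s, 0 < G.exitRate s) (s₀ : S)
    (R : S → S → ℝ) (T : ℝ≥0) :
    ∫⁻ ω, totalReward R (chainAt ω) T ∂G.law s₀ =
      ∑' n, G.transitionReward s₀ T (fun s s' => ENNReal.ofReal (R s s')) n := by
  have hR : Measurable fun p : S × S => ENNReal.ofReal (R p.1 p.2) := .of_discrete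
  have hmeas := fun n => measurableSet_stageStart_le (S := S) T (n + 1)
  have hterm : ∀ n, Measurable fun ω : ℕ → S × ℝ => ENNReal.ofReal (R (ω n).1 (ω (n + 1)).1) :=
    fun n => hR.comp (f := fun ω : ℕ → S × ℝ => ((ω n).1, (ω (n + 1)).1)) (by fun_prop)
  calc ∫⁻ ω, totalReward R (chainAt ω) T ∂G.law s₀
      = ∫⁻ ω, ∑' n, {ω : ℕ → S × ℝ | stageStart ω (n + 1) ≤ T}.indicator
          (fun ω => ENNReal.ofReal (R (ω n).1 (ω (n + 1)).1)) ω ∂G.law s₀ := by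
        refine lintegral_congr_ae ?_
        filter_upwards [G.ae_isJumpPath hG s₀] with ω hω using hω.totalReward_eq R T
    _ = _ := by
        rw [lintegral_tsum fun n => ((hterm n).indicator (hmeas n)).aemeasurable]
        simp only [lintegral_indicator (hmeas _), transitionReward]

theorem lintegral_chainAt (G : Generator S) (hG : ∀ s, 0 < G.exitRate s) (s₀ : S)
    (h : S → ℝ≥0∞) (T : ℝ≥0) :
    ∫⁻ ω, h (chainAt ω T) ∂G.law s₀ = ∑' n, G.currentValue s₀ T h n := by
  have hh : Measurable h := .of_discrete
  have hmeas := measurableSet_stageStart_le_lt (S := S) T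
  calc ∫⁻ ω, h (chainAt ω T) ∂G.law s₀
      = ∫⁻ ω, ∑' n, {ω : ℕ → S × ℝ | stageStart ω n ≤ T ∧ T < stageStart ω (n + 1)}.indicator
          (fun ω => h (ω n).1) ω ∂G.law s₀ := by
        refine lintegral_congr_ae ?_
        filter_upwards [G.ae_isJumpPath hG s₀] with ω hω using hω.apply_chainAt_eq h T
    _ = _ := by
        rw [lintegral_tsum fun n => (Measurable.indicator (by fun_prop) (hmeas n)).aemeasurable]
        simp only [lintegral_indicator (hmeas _), currentValue]

theorem IsBias.lintegral_totalReward_add_lintegral_chainAt {G : Generator S} {R : S → S → ℝ}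
    {g : ℝ≥0∞} {h : S → ℝ≥0∞} (hb : G.IsBias (fun s s' => ENNReal.ofReal (R s s')) g h)
    (hG : ∀ s, 0 < G.exitRate s) (hg : g ≠ ∞) (hh : ∀ s, h s ≠ ∞) (s₀ : S) (T : ℝ≥0) :
    ∫⁻ ω, totalReward R (chainAt ω) T ∂G.law s₀ + ∫⁻ ω, h (chainAt ω T) ∂G.law s₀ =
      g * T + h s₀ := by
  rw [G.lintegral_totalReward hG, G.lintegral_chainAt hG, ← ENNReal.tsum_add]
  have hsum := ENNReal.tendsto_nat_tsum fun n =>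
    G.transitionReward s₀ T (fun s s' => ENNReal.ofReal (R s s')) n + G.currentValue s₀ T h n
  have hlim := hsum.add (G.tendsto_stageValue_zero hG s₀ hg hh T.coe_nonneg)
  simp only [hb.sum_add_stageValue hG s₀ T.coe_nonneg, add_zero, ENNReal.ofReal_coe_nnreal] at hlim
  exact tendsto_nhds_unique hlim tendsto_const_nhds

end Dynkin

section PoissonEquation

variable {S : Type} [Fintype S]

/-- The generator as a linear operator on functions of the state. -/
noncomputable def toLin (G : Generator S) : (S → ℝ) →ₗ[ℝ] S → ℝ :=
  (Matrix.of G.Q).mulVecLin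

variable (G : Generator S) {h : S → ℝ} {s o : S}

theorem toLin_apply (h : S → ℝ) (s : S) : G.toLin h s = ∑ s', G.Q s s' * h s' :=
  rfl

theorem toLin_apply_eq_sum_sub (h : S → ℝ) (s : S) :
    G.toLin h s = ∑ s', G.Q s s' * (h s' - h s) := by
  simp only [mul_sub, Finset.sum_sub_distrib, ← Finset.sum_mul, G.sum_zero, zero_mul, sub_zero,
    toLin_apply]

theorem toLin_sub_const (h : S → ℝ) (c : ℝ) : G.toLin (fun s => h s - c) = G.toLin h := by
  ext s
  simp only [toLin_apply_eq_sum_sub, sub_sub_sub_cancel_right]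

theorem Q_mul_sub_nonpos (hs : ∀ s', h s' ≤ h s) (s' : S) : G.Q s s' * (h s' - h s) ≤ 0 := by
  obtain rfl | hne := eq_or_ne s s'
  · rw [sub_self, mul_zero]
  · exact mul_nonpos_of_nonneg_of_nonpos (G.nonneg s s' hne) (sub_nonpos.2 (hs s'))

theorem toLin_apply_nonpos_of_max (hs : ∀ s', h s' ≤ h s) : G.toLin h s ≤ 0 := by
  rw [toLin_apply_eq_sum_sub]
  exact Finset.sum_nonpos fun s' _ => G.Q_mul_sub_nonpos hs s'

theorem toLin_apply_nonneg_of_min (hs : ∀ s', h s ≤ h s') : 0 ≤ G.toLin h s := by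
  have hneg := G.toLin_apply_nonpos_of_max (h := -h) (s := s) fun s' => neg_le_neg (hs s')
  rwa [map_neg, Pi.neg_apply, neg_nonpos] at hneg

theorem apply_eq_of_toLin_apply_eq_zero (hs : ∀ s', h s' ≤ h s) (hzero : G.toLin h s = 0) {s' : S}
    (hpos : 0 < G.Q s s') : h s' = h s := by
  rw [toLin_apply_eq_sum_sub,
    Finset.sum_eq_zero_iff_of_nonpos fun s' _ => G.Q_mul_sub_nonpos hs s'] at hzero
  exact sub_eq_zero.1 ((mul_eq_zero_iff_left hpos.ne').1 (hzero s' (Finset.mem_univ s')))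

theorem apply_le_of_toLin_eq_zero (ho : ∀ s, Relation.ReflTransGen (fun a b => 0 < G.Q a b) s o)
    (hzero : G.toLin h = 0) (s : S) : h s ≤ h o := by
  have : Nonempty S := ⟨o⟩
  obtain ⟨top, htop⟩ := Finite.exists_max h
  suffices h o = h top from this ▸ htop s
  have hpath := ho top
  clear ho
  induction hpath with
  | refl => rfl
  | tail _ hpos ih =>
    rw [← ih]
    exact G.apply_eq_of_toLin_apply_eq_zero (ih ▸ htop) (congrFun hzero _) hpos

theorem apply_eq_of_toLin_eq_zero (ho : ∀ s, Relation.ReflTransGen (fun a b => 0 < G.Q a b) s o)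
    (hzero : G.toLin h = 0) (s : S) : h s = h o := by
  refine (G.apply_le_of_toLin_eq_zero ho hzero s).antisymm (neg_le_neg_iff.1 ?_)
  exact G.apply_le_of_toLin_eq_zero (h := -h) ho (by rw [map_neg, hzero, neg_zero]) s

theorem injective_const_sub_toLin
    (ho : ∀ s, Relation.ReflTransGen (fun a b => 0 < G.Q a b) s o) :
    Function.Injective
      ((LinearMap.pi fun _ : S => (LinearMap.proj o : (S → ℝ) →ₗ[ℝ] ℝ)) - G.toLin) := by
  refine (injective_iff_map_eq_zero _).2 fun h hh => ?_
  have hconst : ∀ s, G.toLin h s = h o := fun s => (sub_eq_zero.1 (congrFun hh s)).symm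
  have : Nonempty S := ⟨o⟩
  obtain ⟨top, htop⟩ := Finite.exists_max h
  obtain ⟨bot, hbot⟩ := Finite.exists_min h
  have hho : h o = 0 := le_antisymm
    (hconst top ▸ G.toLin_apply_nonpos_of_max htop) (hconst bot ▸ G.toLin_apply_nonneg_of_min hbot)
  ext s
  exact (G.apply_eq_of_toLin_eq_zero ho (funext fun s => (hconst s).trans hho) s).trans hho

theorem exists_add_toLin_eq (ho : ∀ s, Relation.ReflTransGen (fun a b => 0 < G.Q a b) s o)
    (r : S → ℝ) : ∃ (g : ℝ) (h : S → ℝ), (∀ s, 0 ≤ h s) ∧ ∀ s, r s + G.toLin h s = g := by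
  -- Among the solutions, the one with `h o = g` is the solution of `h o - Q h = r`.
  obtain ⟨h, hh⟩ := LinearMap.injective_iff_surjective.1 (G.injective_const_sub_toLin ho) r
  have : Nonempty S := ⟨o⟩
  obtain ⟨bot, hbot⟩ := Finite.exists_min h
  refine ⟨h o, fun s => h s - h bot, fun s => sub_nonneg.2 (hbot s), fun s => ?_⟩
  rw [toLin_sub_const, ← hh]
  exact sub_add_cancel (h o) (G.toLin h s)

theorem exists_le_of_add_toLin_eq [Nonempty S] {r : S → ℝ} {g : ℝ}
    (hgh : ∀ s, r s + G.toLin h s = g) : ∃ s, g ≤ r s := by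
  obtain ⟨top, htop⟩ := Finite.exists_max h
  exact ⟨top, hgh top ▸ add_le_of_nonpos_right (G.toLin_apply_nonpos_of_max htop)⟩

theorem exists_ge_of_add_toLin_eq [Nonempty S] {r : S → ℝ} {g : ℝ}
    (hgh : ∀ s, r s + G.toLin h s = g) : ∃ s, r s ≤ g := by
  obtain ⟨bot, hbot⟩ := Finite.exists_min h
  exact ⟨bot, hgh bot ▸ le_add_of_nonneg_right (G.toLin_apply_nonneg_of_min hbot)⟩

end PoissonEquation

section Gain

variable {S : Type} [Fintype S] [DecidableEq S]

/-- The rate at which rewards accumulate, on average, while the chain is in the state `s`. -/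
noncomputable def rewardRate (G : Generator S) (R : S → S → ℝ) (s : S) : ℝ :=
  ∑ s' ∈ Finset.univ.erase s, G.Q s s' * R s s'

theorem rewardRate_nonneg (G : Generator S) {R : S → S → ℝ} (hR : ∀ s s', 0 ≤ R s s') (s : S) :
    0 ≤ G.rewardRate R s :=
  Finset.sum_nonneg fun s' hs' =>
    mul_nonneg (G.nonneg s s' (Finset.ne_of_mem_erase hs').symm) (hR s s')

theorem sum_erase_Q_mul_add (G : Generator S) (R : S → S → ℝ) (h : S → ℝ) (s : S) :
    ∑ s' ∈ Finset.univ.erase s, G.Q s s' * (R s s' + h s') =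
      G.rewardRate R s + G.toLin h s + G.exitRate s * h s := by
  rw [toLin_apply, ← Finset.add_sum_erase _ _ (Finset.mem_univ s)]
  simp only [mul_add, Finset.sum_add_distrib, rewardRate, exitRate]
  ring

variable [MeasurableSpace S] [DiscreteMeasurableSpace S] {G : Generator S}

theorem isBias_of_rewardRate_add_toLin_eq (hG : ∀ s, 0 < G.exitRate s) {R : S → S → ℝ}
    (hR : ∀ s s', 0 ≤ R s s') {g : ℝ} (hg : 0 ≤ g) {h : S → ℝ} (hh : ∀ s, 0 ≤ h s)
    (hgh : ∀ s, G.rewardRate R s + G.toLin h s = g) :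
    G.IsBias (fun s s' => ENNReal.ofReal (R s s')) (ENNReal.ofReal g)
      fun s => ENNReal.ofReal (h s) := by
  intro s
  have hnonneg : ∀ s' ∈ Finset.univ.erase s, 0 ≤ G.Q s s' / G.exitRate s := fun s' hs' =>
    div_nonneg (G.nonneg s s' (Finset.ne_of_mem_erase hs').symm) (hG s).le
  calc ∫⁻ s', (ENNReal.ofReal (R s s') + ENNReal.ofReal (h s')) ∂G.jumpLaw s
      = ∑ s' ∈ Finset.univ.erase s,
          ENNReal.ofReal (G.Q s s' / G.exitRate s * (R s s' + h s')) := by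
        rw [G.lintegral_jumpLaw (hG s)]
        refine Finset.sum_congr rfl fun s' hs' => ?_
        rw [← ENNReal.ofReal_add (hR s s') (hh s'), ← ENNReal.ofReal_mul (hnonneg s' hs')]
    _ = ENNReal.ofReal (g * (G.exitRate s)⁻¹ + h s) := by
        rw [← ENNReal.ofReal_sum_of_nonneg fun s' hs' =>
          mul_nonneg (hnonneg s' hs') (add_nonneg (hR s s') (hh s'))]
        simp only [div_mul_eq_mul_div, ← Finset.sum_div, G.sum_erase_Q_mul_add, hgh, add_div,
          mul_div_cancel_left₀ _ (hG s).ne', div_eq_mul_inv g]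
    _ = ENNReal.ofReal g * ENNReal.ofReal (G.exitRate s)⁻¹ + ENNReal.ofReal (h s) := by
        rw [ENNReal.ofReal_add (mul_nonneg hg (inv_nonneg.2 (hG s).le)) (hh s),
          ENNReal.ofReal_mul hg]

theorem IsBias.lintegral_totalReward_ne_top_and_tendsto_div {R : S → S → ℝ} {g : ℝ≥0}
    {h : S → ℝ≥0} (hb : G.IsBias (fun s s' => ENNReal.ofReal (R s s')) g fun s => h s)
    (hG : ∀ s, 0 < G.exitRate s) (s₀ : S) :
    (∀ T, ∫⁻ ω, totalReward R (chainAt ω) T ∂G.law s₀ ≠ ∞) ∧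
      Tendsto (fun T : ℝ≥0 => (∫⁻ ω, totalReward R (chainAt ω) T ∂G.law s₀).toReal / (T : ℝ))
        atTop (𝓝 g) := by
  have hdynkin := hb.lintegral_totalReward_add_lintegral_chainAt hG ENNReal.coe_ne_top
    (fun _ => ENNReal.coe_ne_top) s₀
  have : Nonempty S := ⟨s₀⟩
  obtain ⟨best, hbest⟩ := Finite.exists_max h
  have hle (T : ℝ≥0) : ∫⁻ ω, totalReward R (chainAt ω) T ∂G.law s₀ ≤ g * T + h best :=
    calc _ ≤ g * T + (h s₀ : ℝ≥0∞) := le_self_add.trans_eq (hdynkin T)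
      _ ≤ g * T + h best := by
        gcongr
        exact hbest s₀
  have hge (T : ℝ≥0) : g * T ≤ ∫⁻ ω, totalReward R (chainAt ω) T ∂G.law s₀ + h best :=
    calc _ ≤ _ := le_self_add.trans_eq (hdynkin T).symm
      _ ≤ ∫⁻ ω, totalReward R (chainAt ω) T ∂G.law s₀ + ∫⁻ _, (h best : ℝ≥0∞) ∂G.law s₀ := by
        gcongr
        exact hbest _
      _ = _ := by rw [lintegral_const, measure_univ, mul_one]
  exact ⟨fun T => ne_top_of_le_ne_top (by finiteness) (hle T),
    tendsto_toReal_div_coe_atTop hle hge⟩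

theorem exists_gain_le (hG : ∀ s, 0 < G.exitRate s) {o : S}
    (ho : ∀ s, Relation.ReflTransGen (fun a b => 0 < G.Q a b) s o) {R : S → S → ℝ}
    (hR : ∀ s s', 0 ≤ R s s') {M : ℝ} (hM : ∀ s, G.rewardRate R s ≤ M) :
    ∃ g ≤ M, ∀ s₀, (∀ T, ∫⁻ ω, totalReward R (chainAt ω) T ∂G.law s₀ ≠ ∞) ∧
      Tendsto (fun T : ℝ≥0 => (∫⁻ ω, totalReward R (chainAt ω) T ∂G.law s₀).toReal / (T : ℝ))
        atTop (𝓝 g) := by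
  obtain ⟨g, h, hh, hgh⟩ := G.exists_add_toLin_eq ho (G.rewardRate R)
  have : Nonempty S := ⟨o⟩
  obtain ⟨top, htop⟩ := G.exists_le_of_add_toLin_eq hgh
  obtain ⟨bot, hbot⟩ := G.exists_ge_of_add_toLin_eq hgh
  have hg : 0 ≤ g := (G.rewardRate_nonneg hR bot).trans hbot
  have hb := isBias_of_rewardRate_add_toLin_eq hG hR hg hh hgh
  have hgain := IsBias.lintegral_totalReward_ne_top_and_tendsto_div hb hG
  rw [Real.coe_toNNReal g hg] at hgain
  exact ⟨g, htop.trans (hM top), hgain⟩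

end Gain

end Generator

namespace TandemSystem

section Workload

variable {J : ℕ} (Θ : TandemSystem J)

/-- The number of services still needed to empty the line: a job at station `i` has `J - i` of
them ahead. -/
def workload (s : Θ.State) : ℤ := ∑ i : Fin J, ((J : ℤ) - i) * ((s i : ℕ) : ℤ)

theorem workload_nonneg (s : Θ.State) : 0 ≤ Θ.workload s :=
  Finset.sum_nonneg fun i _ =>
    mul_nonneg (sub_nonneg.2 (Int.ofNat_le.2 i.2.le)) (Int.natCast_nonneg _)

theorem sum_mul_unitVec {k : ℕ} (hk : k ≤ J) :
    ∑ i : Fin J, ((J : ℤ) - i) * unitVec J k i = J - k := by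
  simp only [unitVec, mul_ite, mul_one, mul_zero]
  obtain hlt | rfl := hk.lt_or_eq
  · rw [Finset.sum_eq_single_of_mem ⟨k, hlt⟩ (Finset.mem_univ _) fun i _ hi =>
      if_neg fun hik => hi (Fin.ext hik), if_pos rfl]
  · rw [sub_self]
    exact Finset.sum_eq_zero fun i _ => if_neg i.2.ne

variable {Θ} {s s' s'' : Θ.State}

theorem IsEntry.workload_eq (h : Θ.IsEntry s s') : Θ.workload s' = Θ.workload s + J := by
  simp only [workload, h _, mul_add, Finset.sum_add_distrib, sum_mul_unitVec J.zero_le]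
  push_cast
  ring

theorem IsService.workload_eq {j : Fin J} (h : Θ.IsService j s s') :
    Θ.workload s' = Θ.workload s - 1 := by
  simp only [workload, h _, mul_add, mul_sub, Finset.sum_add_distrib, Finset.sum_sub_distrib,
    sum_mul_unitVec j.2.le, sum_mul_unitVec (Nat.succ_le_of_lt j.2)]
  push_cast
  ring

theorem IsService.ne {j : Fin J} (h : Θ.IsService j s s') : s ≠ s' := by
  rintro rfl
  linarith [h.workload_eq]

theorem IsService.not_isEntry {j : Fin J} (h : Θ.IsService j s s') : ¬ Θ.IsEntry s s' := by
  intro he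
  linarith [h.workload_eq, he.workload_eq, Int.natCast_nonneg J]

theorem IsEntry.unique (h : Θ.IsEntry s s') (h' : Θ.IsEntry s s'') : s' = s'' := by
  ext i
  exact_mod_cast (h i).trans (h' i).symm

theorem exists_isService_of_succ_eq_zero {j : Fin J} (hj : s j ≠ 0)
    (hsucc : ∀ i : Fin J, (i : ℕ) = j + 1 → s i = 0) : ∃ s', Θ.IsService j s s' := by
  have hpos : (s j : ℕ) ≠ 0 := Fin.val_ne_zero_iff.2 hj
  refine ⟨fun i => ⟨if i = j then s i - 1 else if (i : ℕ) = j + 1 then 1 else s i, ?_⟩,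
    fun i => ?_⟩
  · have := (s i).2
    split_ifs <;> lia
  · simp only [unitVec, ← Fin.ext_iff]
    split_ifs with hij hij' hij'
    · lia
    · subst hij
      lia
    · simp [hsucc i hij']
    · simp

theorem exists_isService (hs : s ≠ 0) : ∃ j s', Θ.IsService j s s' := by
  obtain ⟨i, hi⟩ := Function.ne_iff.1 hs
  obtain ⟨last, hne, hlast⟩ := Finset.exists_max_image {i | s i ≠ 0} id
    ⟨i, (Finset.mem_filter_univ i).2 hi⟩
  refine ⟨last, exists_isService_of_succ_eq_zero ((Finset.mem_filter_univ last).1 hne) ?_⟩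
  intro i hi
  by_contra hi'
  have hle : i ≤ last := hlast i ((Finset.mem_filter_univ i).2 hi')
  lia

theorem exists_isEntry_zero (hJ : 1 ≤ J) : ∃ s' : Θ.State, s' ≠ 0 ∧ Θ.IsEntry 0 s' := by
  refine ⟨fun i => if (i : ℕ) = 0 then 1 else 0, Function.ne_iff.2 ⟨⟨0, hJ⟩, by simp⟩, ?_⟩
  intro i
  by_cases h : (i : ℕ) = 0 <;> simp [unitVec, h]

end Workload

section Policy

variable {J : ℕ} {Θ : TandemSystem J} {A : Set ℝ} (π : Θ.State → A) {s s' : Θ.State}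

theorem generator_Q_of_ne (h : s ≠ s') : (Θ.generator π).Q s s' = Θ.rate π s s' :=
  if_neg h

theorem generator_Q_pos_of_isService {j : Fin J} (h : Θ.IsService j s s') :
    0 < (Θ.generator π).Q s s' := by
  rw [generator_Q_of_ne π h.ne, rate, if_neg h.not_isEntry]
  refine Finset.sum_pos' (fun i _ => ?_) ⟨j, Finset.mem_univ j, ?_⟩
  · split_ifs
    exacts [(Θ.μ_pos i).le, le_rfl]
  · rw [if_pos h]
    exact Θ.μ_pos j

theorem reflTransGen_generator_Q_pos_zero (s : Θ.State) :
    Relation.ReflTransGen (fun a b => 0 < (Θ.generator π).Q a b) s 0 := by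
  induction hn : (Θ.workload s).toNat using Nat.strong_induction_on generalizing s with
  | _ n ih =>
    obtain rfl | hs := eq_or_ne s 0
    · rfl
    · obtain ⟨j, s', h⟩ := exists_isService hs
      have hlt : (Θ.workload s').toNat < n := by
        have := h.workload_eq
        have := Θ.workload_nonneg s'
        lia
      exact .head (generator_Q_pos_of_isService π h) (ih _ hlt s' rfl)

theorem exists_generator_Q_pos (hJ : 1 ≤ J) (hentry : ∀ a ∈ A, 0 < Θ.entryProb a) (s : Θ.State) :
    ∃ s', s' ≠ s ∧ 0 < (Θ.generator π).Q s s' := by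
  obtain rfl | hs := eq_or_ne s 0
  · obtain ⟨s', hne, h⟩ := exists_isEntry_zero (Θ := Θ) hJ
    refine ⟨s', hne, ?_⟩
    rw [generator_Q_of_ne π hne.symm, rate, if_pos h]
    exact mul_pos Θ.lam_pos (hentry _ (π 0).2)
  · obtain ⟨j, s', h⟩ := exists_isService hs
    exact ⟨s', h.ne.symm, generator_Q_pos_of_isService π h⟩

theorem exitRate_pos (hJ : 1 ≤ J) (hentry : ∀ a ∈ A, 0 < Θ.entryProb a) (s : Θ.State) :
    0 < (Θ.generator π).exitRate s := by
  obtain ⟨s', hne, hQ⟩ := exists_generator_Q_pos π hJ hentry s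
  rw [← Generator.sum_erase]
  exact Finset.sum_pos' (fun t ht => (Θ.generator π).nonneg s t (Finset.ne_of_mem_erase ht).symm)
    ⟨s', Finset.mem_erase.2 ⟨hne, Finset.mem_univ _⟩, hQ⟩

theorem reward_nonneg (hA : ∀ a ∈ A, 0 ≤ a) (s s' : Θ.State) : 0 ≤ Θ.reward π s s' := by
  rw [reward]
  split_ifs
  exacts [hA _ (π s).2, le_rfl]

theorem rewardRate_reward_le (hs : 0 ≤ (π s : ℝ)) :
    (Θ.generator π).rewardRate (Θ.reward π) s ≤ π s * Θ.lam * Θ.entryProb (π s) := by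
  have hzero (s') (h : ¬ Θ.IsEntry s s') : (Θ.generator π).Q s s' * Θ.reward π s s' = 0 := by
    rw [reward, if_neg h, mul_zero]
  rw [Generator.rewardRate]
  by_cases hex : ∃ s' ∈ Finset.univ.erase s, Θ.IsEntry s s'
  · obtain ⟨s', hs', h⟩ := hex
    rw [Finset.sum_eq_single_of_mem s' hs' fun t _ ht => hzero t fun h' => ht (h'.unique h),
      generator_Q_of_ne π (Finset.ne_of_mem_erase hs').symm, rate, reward, if_pos h, if_pos h]
    exact (by ring : _ = _).le
  · rw [Finset.sum_eq_zero fun s' hs' => hzero s' fun h => hex ⟨s', hs', h⟩]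
    exact mul_nonneg (mul_nonneg hs Θ.lam_pos.le) (Θ.entryProb_nonneg _)

theorem exists_isGain_le (hJ : 1 ≤ J) (hA : ∀ a ∈ A, 0 ≤ a)
    (hentry : ∀ a ∈ A, 0 < Θ.entryProb a) {M : ℝ}
    (hM : ∀ a ∈ A, a * Θ.lam * Θ.entryProb a ≤ M) : ∃ g, Θ.IsGain π g ∧ g ≤ M := by
  obtain ⟨g, hgM, hg⟩ := Generator.exists_gain_le (exitRate_pos π hJ hentry)
    (reflTransGen_generator_Q_pos_zero π) (reward_nonneg π hA)
    fun s => (rewardRate_reward_le π (hA _ (π s).2)).trans (hM _ (π s).2)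
  exact ⟨g, hg, hgM⟩

variable {π} in
theorem IsGain.unique {g g' : ℝ} (h : Θ.IsGain π g) (h' : Θ.IsGain π g') : g = g' :=
  tendsto_nhds_unique (h 0).2 (h' 0).2

end Policy

end TandemSystem

theorem proposition1_general {J : ℕ} (hJ : 1 ≤ J) (Θ : TandemSystem J) (A : Set ℝ)
    (hA : ∀ a ∈ A, 0 ≤ a) (hentry : ∀ a ∈ A, 0 < Θ.entryProb a)
    (M : ℝ) (hM : IsLUB ((fun a => a * Θ.lam * Θ.entryProb a) '' A) M) :
    (∀ π : Θ.State → A, ∃ g, Θ.IsGain π g ∧ g ≤ M) ∧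
      ∃ gopt, IsLUB {g | ∃ π : Θ.State → A, Θ.IsGain π g} gopt ∧ gopt ≤ M := by
  have hgain (π : Θ.State → A) : ∃ g, Θ.IsGain π g ∧ g ≤ M :=
    TandemSystem.exists_isGain_le π hJ hA hentry fun a ha => hM.1 ⟨a, ha, rfl⟩
  have hub : M ∈ upperBounds {g | ∃ π : Θ.State → A, Θ.IsGain π g} := by
    rintro g ⟨π, hg⟩
    obtain ⟨g', hg', hle⟩ := hgain π
    exact (hg.unique hg').trans_le hle
  have hne : {g | ∃ π : Θ.State → A, Θ.IsGain π g}.Nonempty := by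
    obtain ⟨a, ha⟩ := hM.nonempty.of_image
    obtain ⟨g, hg, -⟩ := hgain fun _ => ⟨a, ha⟩
    exact ⟨g, _, hg⟩
  exact ⟨hgain, _, isLUB_csSup hne ⟨M, hub⟩, csSup_le hne hub⟩

theorem proposition1 {J : ℕ} (hJ : 1 ≤ J) (Θ : TandemSystem J) (A : Set ℝ)
    (hA : ∀ a ∈ A, 0 ≤ a) (hentry : ∀ a ∈ A, 0 < Θ.entryProb a)
    (M : ℝ) (hM : IsGreatest ((fun a => a * Θ.lam * Θ.entryProb a) '' A) M) :
    (∀ π : Θ.State → A, ∃ g, Θ.IsGain π g ∧ g ≤ M) ∧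
      ∃ gopt, IsLUB {g | ∃ π : Θ.State → A, Θ.IsGain π g} gopt ∧ gopt ≤ M :=
  proposition1_general hJ Θ A hA hentry M hM.isLUB
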